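/- Let $1\le m\le k\le n$ be integers and let $A\in M(n)$ be a complex $n\times n$ matrix. Let $\otimes^k\mathbb C^n$ be the $k$-fold tensor power of the Hilbert space $\mathbb C^n$, with the inner product determined by $\langle x_1\otimes\cdots\otimes x_k,\;y_1\otimes\cdots\otimes y_k\rangle=\prod_{i=1}^k\langle x_i,y_i\rangle$, and let $\vee^k\mathbb C^n\subseteq\otimes^k\mathbb C^n$ be the subspace of tensors invariant under all permutations of the $k$ factors. For $B\in M(n)$ let $\vee^k B$ be the restriction to $\vee^k\mathbb C^n$ of $\otimes^k B$, the operator with $x_1\otimes\cdots\otimes x_k\mapsto Bx_1\otimes\cdots\otimes Bx_k$; it leaves $\vee^k\mathbb C^n$ invariant. Then the map $\vee^k\colon M(n)\to\mathscr L(\vee^k\mathbb C^n)$, $B\mapsto\vee^k B$, is infinitely differentiable, and its $m$-th derivative $D^m\vee^k(A)$ at $A$, a symmetric $m$-linear map $M(n)^m\to\mathscr L(\vee^k\mathbb C^n)$, satisfies $$\|D^m\vee^k(A)\|=\frac{k!}{(k-m)!}\,\|A\|^{k-m}.$$ Here matrices and operators carry the operator norm, and $\|D^m\vee^k(A)\|=\sup\{\|D^m\vee^k(A)(X^1,\dots,X^m)\|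 : \|X^1\|=\cdots=\|X^m\|=1\}$. -/

import Mathlib

open scoped Matrix.Norms.L2Operator ContDiff

noncomputable section

namespace SymTensor

/-- The `k`-fold tensor power `⊗^k ℂⁿ` as a Hilbert space, in coordinates: the coordinate of a
tensor at the multi-index `f : Fin k → Fin n` is its coefficient at the basis tensor
`e_{f 0} ⊗ ⋯ ⊗ e_{f (k-1)}`, and these basis tensors are orthonormal. -/
abbrev TensorPower (n k : ℕ) : Type := EuclideanSpace ℂ (Fin k → Fin n)

/-- The elementary tensor `x₀ ⊗ ⋯ ⊗ x_{k-1}`. -/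
def elementary {n k : ℕ} (x : Fin k → EuclideanSpace ℂ (Fin n)) : TensorPower n k :=
  WithLp.toLp 2 fun f => ∏ i, x i (f i)

/-- The inner product on `⊗^k ℂⁿ` is the usual one of a tensor product of Hilbert spaces. -/
theorem inner_elementary {n k : ℕ} (x y : Fin k → EuclideanSpace ℂ (Fin n)) :
    inner ℂ (elementary x) (elementary y) = ∏ i, inner ℂ (x i) (y i) := by
  simp only [elementary, PiLp.inner_apply, RCLike.inner_apply, map_prod, ← Finset.prod_mul_distrib]
  exact (Fintype.prod_sum fun i j => y i j * (starRingEnd ℂ) (x i j)).symm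

/-- The operator `⊗^k A` on `⊗^k ℂⁿ`, given by the `k`-fold Kronecker power of the matrix `A`. -/
def tensorPow {n : ℕ} (k : ℕ) (A : Matrix (Fin n) (Fin n) ℂ) :
    TensorPower n k →L[ℂ] TensorPower n k :=
  Matrix.toEuclideanCLM (𝕜 := ℂ) (Matrix.of fun f g : Fin k → Fin n => ∏ i, A (f i) (g i))

theorem tensorPow_apply {n k : ℕ} (A : Matrix (Fin n) (Fin n) ℂ) (v : TensorPower n k)
    (f : Fin k → Fin n) : tensorPow k A v f = ∑ g, (∏ i, A (f i) (g i)) * v g := rfl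

/-- `⊗^k A` sends `x₀ ⊗ ⋯ ⊗ x_{k-1}` to `A x₀ ⊗ ⋯ ⊗ A x_{k-1}`. -/
theorem tensorPow_elementary {n k : ℕ} (A : Matrix (Fin n) (Fin n) ℂ)
    (x : Fin k → EuclideanSpace ℂ (Fin n)) :
    tensorPow k A (elementary x) =
      elementary fun i => Matrix.toEuclideanCLM (𝕜 := ℂ) A (x i) := by
  ext f
  rw [tensorPow_apply]
  simp only [elementary, ← Finset.prod_mul_distrib]
  exact (Fintype.prod_sum fun i j => A (f i) j * x i j).symm

/-- The symmetric tensor power `∨^k ℂⁿ`: the subspace of `⊗^k ℂⁿ` of the tensors that are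
invariant under all permutations of the `k` tensor factors, with the induced inner product. -/
def SymPower (n k : ℕ) : Submodule ℂ (TensorPower n k) where
  carrier := {v | ∀ (σ : Equiv.Perm (Fin k)) (f : Fin k → Fin n), v (f ∘ σ) = v f}
  add_mem' := fun {v w} hv hw σ f => by simp [hv σ f, hw σ f]
  zero_mem' := fun σ f => by simp
  smul_mem' := fun c v hv σ f => by simp [hv σ f]

/-- `⊗^k A` leaves `∨^k ℂⁿ` invariant. -/
theorem tensorPow_mem {n k : ℕ} (A : Matrix (Fin n) (Fin n) ℂ) {v : TensorPower n k}
    (hv : v ∈ SymPower n k) : tensorPow k A v ∈ SymPower n k := by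
  intro σ f
  rw [tensorPow_apply, tensorPow_apply]
  refine Fintype.sum_equiv (σ.arrowCongr (Equiv.refl _)) _ _ fun g => ?_
  have h1 : (σ.arrowCongr (Equiv.refl (Fin n))) g = g ∘ σ.symm := rfl
  rw [h1, hv σ.symm g]
  congr 1
  exact Fintype.prod_equiv σ _ _ fun i => by simp

/-- The symmetric tensor power `∨^k A`: the restriction of `⊗^k A` to `∨^k ℂⁿ`. -/
def symPow {n : ℕ} (k : ℕ) (A : Matrix (Fin n) (Fin n) ℂ) :
    SymPower n k →L[ℂ] SymPower n k :=
  ((tensorPow k A).comp (SymPower n k).subtypeL).codRestrict (SymPower n k)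
    fun v => tensorPow_mem A v.2

end SymTensor

end

/-!
The map `∨^k` is the restriction to the diagonal of the `k`-linear map sending `(A₀, …, A_{k-1})`
to the compression of `A₀ ⊗ ⋯ ⊗ A_{k-1}` to `∨^k ℂⁿ`. This gives smoothness, and since
`‖A₀ ⊗ ⋯ ⊗ A_{k-1}‖ ≤ ∏ ‖Aᵢ‖` (`SymTensor.sum_norm_sq_prod_le`), the multilinear map has norm at
most `1`. The `m`-th derivative of the restriction to the diagonal of such a map is bounded by
`k (k-1) ⋯ (k-m+1) ‖x‖^(k-m)` (`MultilinearMap.norm_iteratedFDeriv_diagonal_le`), which is the upper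
bound.

For the lower bound, choose a unit vector `v` at which `A` attains its norm, a unit vector `w` with
`A v = ‖A‖ w`, and the contraction `U = w v*` (`SymTensor.exists_contraction`). Then
`∨^k (A + t U)` sends `v ⊗ ⋯ ⊗ v` to `(‖A‖ + t)^k (w ⊗ ⋯ ⊗ w)`, and the `m`-th derivative of this
curve at `t = 0` has norm `k (k-1) ⋯ (k-m+1) ‖A‖^(k-m)`, while composing with the contractions
`t ↦ t U` and `T ↦ T (v ⊗ ⋯ ⊗ v)` cannot increase the norm of the derivative
(`descFactorial_mul_norm_pow_le_norm_iteratedFDeriv`).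
-/

open scoped Matrix.Norms.L2Operator ContDiff

noncomputable section

namespace SymTensor

variable {n k : ℕ}

/-! ### The tensor product of operators -/

/-- The `ℓ²` operator bound of a matrix, in coordinates. -/
theorem sum_norm_sq_mulVec_le (A : Matrix (Fin n) (Fin n) ℂ) (x : Fin n → ℂ) :
    ∑ a, ‖∑ b, A a b * x b‖ ^ 2 ≤ ‖A‖ ^ 2 * ∑ b, ‖x b‖ ^ 2 := by
  have h := A.l2_opNorm_mulVec (WithLp.toLp 2 x)
  have h2 := pow_le_pow_left₀ (norm_nonneg _) h 2
  rw [mul_pow, EuclideanSpace.norm_sq_eq, EuclideanSpace.norm_sq_eq] at h2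
  exact h2

/-- The norm of `A₀ ⊗ ⋯ ⊗ A_{k-1}` is at most `∏ ‖Aᵢ‖`, in coordinates: the factor `A₀` acts on the
first index of the tensor, and the remaining factors act on each slice. -/
theorem sum_norm_sq_prod_le (A : Fin k → Matrix (Fin n) (Fin n) ℂ) (v : (Fin k → Fin n) → ℂ) :
    ∑ f : Fin k → Fin n, ‖∑ g, (∏ i, A i (f i) (g i)) * v g‖ ^ 2 ≤
      (∏ i, ‖A i‖) ^ 2 * ∑ g, ‖v g‖ ^ 2 := by
  induction k with
  | zero => simp
  | succ k ih =>
    have hcons {M : Type} [AddCommMonoid M] (F : (Fin (k + 1) → Fin n) → M) :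
        ∑ f, F f = ∑ f, ∑ a, F (Fin.cons a f) := by
      rw [← (Fin.consEquiv fun _ => Fin n).sum_comp F, Fintype.sum_prod_type_right]
      rfl
    rw [hcons, hcons fun g => ‖v g‖ ^ 2]
    calc ∑ f, ∑ a, ‖∑ g, (∏ i, A i (Fin.cons (α := fun _ => Fin n) a f i) (g i)) * v g‖ ^ 2
        = ∑ f : Fin k → Fin n, ∑ a, ‖∑ b, A 0 a b *
            ∑ g, (∏ i, A i.succ (f i) (g i)) * v (Fin.cons b g)‖ ^ 2 := by
          refine Finset.sum_congr rfl fun f _ => Finset.sum_congr rfl fun a _ => ?_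
          rw [hcons, Finset.sum_comm]
          simp only [Fin.prod_univ_succ, Fin.cons_zero, Fin.cons_succ, Finset.mul_sum, mul_assoc]
      _ ≤ ∑ f : Fin k → Fin n, ‖A 0‖ ^ 2 *
            ∑ b, ‖∑ g, (∏ i, A i.succ (f i) (g i)) * v (Fin.cons b g)‖ ^ 2 :=
          Finset.sum_le_sum fun f _ => sum_norm_sq_mulVec_le _ _
      _ = ‖A 0‖ ^ 2 * ∑ b, ∑ f : Fin k → Fin n,
            ‖∑ g, (∏ i, A i.succ (f i) (g i)) * v (Fin.cons b g)‖ ^ 2 := by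
          rw [← Finset.mul_sum, Finset.sum_comm]
      _ ≤ ‖A 0‖ ^ 2 * ∑ b, (∏ i : Fin k, ‖A i.succ‖) ^ 2 *
            ∑ g : Fin k → Fin n, ‖v (Fin.cons b g)‖ ^ 2 := by
          gcongr with b
          exact ih _ _
      _ = (∏ i, ‖A i‖) ^ 2 * ∑ g : Fin k → Fin n, ∑ b, ‖v (Fin.cons b g)‖ ^ 2 := by
          rw [← Finset.mul_sum, Finset.sum_comm, Fin.prod_univ_succ]
          ring

/-- The multilinear map `(A₀, …, A_{k-1}) ↦ A₀ ⊗ ⋯ ⊗ A_{k-1}`, with the tensor product of the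
matrices written as a Kronecker product. -/
def kroneckerMultilinear (n k : ℕ) :
    MultilinearMap ℂ (fun _ : Fin k => Matrix (Fin n) (Fin n) ℂ)
      (Matrix (Fin k → Fin n) (Fin k → Fin n) ℂ) where
  toFun A := Matrix.of fun f g => ∏ i, A i (f i) (g i)
  map_update_add' {inst} A i x y := by
    obtain rfl := Subsingleton.elim inst (instDecidableEqFin k)
    ext f g
    have h (z : Matrix (Fin n) (Fin n) ℂ) (j : Fin k) : Function.update A i z j (f j) (g j) =
        Function.update (fun j => A j (f j) (g j)) i (z (f i) (g i)) j := by
      rcases eq_or_ne j i with rfl | hj <;> simp [*]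
    simp [h, Finset.prod_update_of_mem, add_mul]
  map_update_smul' {inst} A i c x := by
    obtain rfl := Subsingleton.elim inst (instDecidableEqFin k)
    ext f g
    have h (z : Matrix (Fin n) (Fin n) ℂ) (j : Fin k) : Function.update A i z j (f j) (g j) =
        Function.update (fun j => A j (f j) (g j)) i (z (f i) (g i)) j := by
      rcases eq_or_ne j i with rfl | hj <;> simp [*]
    simp [h, Finset.prod_update_of_mem, mul_assoc]

theorem norm_kroneckerMultilinear_le (A : Fin k → Matrix (Fin n) (Fin n) ℂ) :
    ‖Matrix.toEuclideanCLM (𝕜 := ℂ) (kroneckerMultilinear n k A)‖ ≤ ∏ i, ‖A i‖ := by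
  refine ContinuousLinearMap.opNorm_le_bound _ (by positivity) fun v => ?_
  refine le_of_sq_le_sq ?_ (by positivity)
  rw [mul_pow, EuclideanSpace.norm_sq_eq, EuclideanSpace.norm_sq_eq]
  exact sum_norm_sq_prod_le A v

/-! ### Compression to the symmetric tensors -/

/-- The compression `T ↦ P T ι` of operators on `⊗^k ℂⁿ` to `∨^k ℂⁿ`, where `ι` is the inclusion and
`P` the orthogonal projection. -/
def compression (n k : ℕ) :
    (TensorPower n k →L[ℂ] TensorPower n k) →ₗ[ℂ] (SymPower n k →L[ℂ] SymPower n k) where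
  toFun T := (SymPower n k).orthogonalProjectionOnto ∘L T ∘L (SymPower n k).subtypeL
  map_add' S T := by ext; simp
  map_smul' c T := by ext; simp

theorem norm_compression_le (T : TensorPower n k →L[ℂ] TensorPower n k) :
    ‖compression n k T‖ ≤ ‖T‖ := by
  refine ContinuousLinearMap.opNorm_le_bound _ (norm_nonneg _) fun v => ?_
  refine ((SymPower n k).orthogonalProjectionOnto.le_opNorm _).trans ?_
  refine (mul_le_of_le_one_left (norm_nonneg _)
    (SymPower n k).orthogonalProjectionOnto_norm_le).trans ?_
  exact T.le_opNorm v

/-- The multilinear map sending `(A₀, …, A_{k-1})` to the compression of `A₀ ⊗ ⋯ ⊗ A_{k-1}` to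
`∨^k ℂⁿ`. -/
def symMultilinear (n k : ℕ) :
    MultilinearMap ℂ (fun _ : Fin k => Matrix (Fin n) (Fin n) ℂ)
      (SymPower n k →L[ℂ] SymPower n k) :=
  (compression n k ∘ₗ
    (Matrix.toEuclideanCLM (n := Fin k → Fin n) (𝕜 := ℂ)).toAlgEquiv.toLinearMap
    ).compMultilinearMap (kroneckerMultilinear n k)

theorem norm_symMultilinear_le (A : Fin k → Matrix (Fin n) (Fin n) ℂ) :
    ‖symMultilinear n k A‖ ≤ ∏ i, ‖A i‖ :=
  (norm_compression_le _).trans (norm_kroneckerMultilinear_le A)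

/-- No projection is needed on the diagonal, because `⊗^k A` leaves `∨^k ℂⁿ` invariant. -/
theorem symPow_eq_symMultilinear (A : Matrix (Fin n) (Fin n) ℂ) :
    symPow k A = symMultilinear n k fun _ => A := by
  ext1 v
  exact ((SymPower n k).orthogonalProjectionOnto_mem_subspace_eq_self (symPow k A v)).symm

end SymTensor

/-! ### Derivatives of a multilinear map on the diagonal -/

namespace MultilinearMap

variable {k : ℕ} {E F : Type*} [NormedAddCommGroup E] [NormedSpace ℂ E] [NormedAddCommGroup F]
  [NormedSpace ℂ F]

theorem apply_diagonal_eq_comp (f : MultilinearMap ℂ (fun _ : Fin k => E) F)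
    (hf : ∀ x, ‖f x‖ ≤ ∏ i, ‖x i‖) :
    (fun x => f fun _ => x) = f.mkContinuous 1 (fun x => (hf x).trans_eq (one_mul _).symm) ∘
      ContinuousLinearMap.pi fun _ => ContinuousLinearMap.id ℂ E :=
  rfl

theorem contDiff_diagonal (f : MultilinearMap ℂ (fun _ : Fin k => E) F)
    (hf : ∀ x, ‖f x‖ ≤ ∏ i, ‖x i‖) {g : E → F} (hg : ∀ x, g x = f fun _ => x) {N : ℕ∞ω} :
    ContDiff ℂ N g := by
  rw [funext hg, apply_diagonal_eq_comp f hf]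
  exact (ContinuousMultilinearMap.contDiff _).comp (ContinuousLinearMap.contDiff _)

/-- The diagonal embedding `x ↦ (x, …, x)` is a contraction for the supremum norm, so the bound for
the derivatives of a multilinear map on the product carries over to the diagonal. -/
theorem norm_iteratedFDeriv_diagonal_le (f : MultilinearMap ℂ (fun _ : Fin k => E) F)
    (hf : ∀ x, ‖f x‖ ≤ ∏ i, ‖x i‖) {g : E → F} (hg : ∀ x, g x = f fun _ => x) (m : ℕ) (x : E) :
    ‖iteratedFDeriv ℂ m g x‖ ≤ k.descFactorial m * ‖x‖ ^ (k - m) := by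
  rw [funext hg, apply_diagonal_eq_comp f hf,
    ContinuousLinearMap.iteratedFDeriv_comp_right (n := m) _
      (ContinuousMultilinearMap.contDiff _) x le_rfl]
  refine (ContinuousMultilinearMap.norm_compContinuousLinearMap_le _ _).trans ?_
  have hdiag (y : E) : ‖fun _ : Fin k => y‖ ≤ ‖y‖ :=
    (pi_norm_le_iff_of_nonneg (norm_nonneg y)).2 fun _ => le_rfl
  refine (mul_le_of_le_one_right (norm_nonneg _) (Finset.prod_le_one (fun _ _ => norm_nonneg _)
    fun _ _ => ContinuousLinearMap.opNorm_le_bound _ zero_le_one fun y =>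
      (hdiag y).trans_eq (one_mul _).symm)).trans ?_
  refine (ContinuousMultilinearMap.norm_iteratedFDeriv_le _ m _).trans ?_
  rw [Fintype.card_fin]
  gcongr
  · exact mul_le_of_le_one_right (by positivity) (f.mkContinuous_norm_le zero_le_one _)
  · exact hdiag x

end MultilinearMap

/-- If a contraction `φ` maps the restriction of `f` to the line `t ↦ x + t u`, `‖u‖ ≤ 1`, to
`t ↦ (a + t)^k W` with `W` a unit vector, then the derivatives of `f` at `x` are at least as large
as those of `t ↦ (a + t)^k` at `0`. -/
theorem descFactorial_mul_norm_pow_le_norm_iteratedFDeriv {E F G : Type*} [NormedAddCommGroup E]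
    [NormedSpace ℂ E] [NormedAddCommGroup F] [NormedSpace ℂ F] [NormedAddCommGroup G]
    [NormedSpace ℂ G] {f : E → F} {m : ℕ} (hf : ContDiff ℂ m f) {x u : E} (hu : ‖u‖ ≤ 1)
    (φ : F →ₗ[ℂ] G) (hφ : ∀ y, ‖φ y‖ ≤ ‖y‖) {k : ℕ} {a : ℂ} {W : G} (hW : ‖W‖ = 1)
    (hline : ∀ t : ℂ, φ (f (x + t • u)) = (a + t) ^ k • W) :
    k.descFactorial m * ‖a‖ ^ (k - m) ≤ ‖iteratedFDeriv ℂ m f x‖ := by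
  have hφ1 (y : F) : ‖φ y‖ ≤ 1 * ‖y‖ := (hφ y).trans_eq (one_mul _).symm
  let Φ : F →L[ℂ] G := φ.mkContinuous 1 hφ1
  let L : ℂ →L[ℂ] E := ContinuousLinearMap.toSpanSingleton ℂ u
  have hL : ‖L‖ ≤ 1 := (ContinuousLinearMap.norm_toSpanSingleton u).le.trans hu
  have hf' : ContDiff ℂ m fun y => f (x + y) := hf.comp (contDiff_const.add contDiff_id)
  have hcurve : Φ ∘ (fun y => f (x + y)) ∘ L = fun t : ℂ => (a + t) ^ k • W := funext hline
  have hderiv : ‖iteratedFDeriv ℂ m (Φ ∘ (fun y => f (x + y)) ∘ L) 0‖ =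
      k.descFactorial m * ‖a‖ ^ (k - m) := by
    rw [hcurve, norm_iteratedFDeriv_eq_norm_iteratedDeriv,
      iteratedDeriv_smul_const (by fun_prop) W,
      iteratedDeriv_comp_const_add m (fun z : ℂ => z ^ k) a, norm_smul, hW]
    simp
  rw [← hderiv]
  calc ‖iteratedFDeriv ℂ m (Φ ∘ (fun y => f (x + y)) ∘ L) 0‖
      ≤ ‖Φ‖ * ‖iteratedFDeriv ℂ m ((fun y => f (x + y)) ∘ L) 0‖ :=
        Φ.norm_iteratedFDeriv_comp_left (N := m) (hf'.comp L.contDiff).contDiffAt le_rfl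
    _ ≤ ‖iteratedFDeriv ℂ m ((fun y => f (x + y)) ∘ L) 0‖ :=
        mul_le_of_le_one_left (norm_nonneg _) (φ.mkContinuous_norm_le zero_le_one hφ1)
    _ ≤ ‖iteratedFDeriv ℂ m (fun y => f (x + y)) (L 0)‖ * ∏ _i : Fin m, ‖L‖ := by
        rw [L.iteratedFDeriv_comp_right (n := m) hf' 0 le_rfl]
        exact ContinuousMultilinearMap.norm_compContinuousLinearMap_le _ _
    _ ≤ ‖iteratedFDeriv ℂ m (fun y => f (x + y)) (L 0)‖ :=
        mul_le_of_le_one_right (norm_nonneg _)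
          (Finset.prod_le_one (fun _ _ => norm_nonneg _) fun _ _ => hL)
    _ = ‖iteratedFDeriv ℂ m f x‖ := by
        rw [iteratedFDeriv_comp_add_left, map_zero, add_zero]

namespace SymTensor

variable {n k : ℕ}

theorem contDiff_symPow {N : ℕ∞ω} :
    ContDiff ℂ N (fun B : Matrix (Fin n) (Fin n) ℂ => symPow k B) :=
  MultilinearMap.contDiff_diagonal (E := Matrix (Fin n) (Fin n) ℂ)
    (F := SymPower n k →L[ℂ] SymPower n k) (symMultilinear n k) norm_symMultilinear_le
    symPow_eq_symMultilinear

theorem norm_iteratedFDeriv_symPow_le (m : ℕ) (A : Matrix (Fin n) (Fin n) ℂ) :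
    ‖iteratedFDeriv ℂ m (fun B : Matrix (Fin n) (Fin n) ℂ => symPow k B) A‖ ≤
      k.descFactorial m * ‖A‖ ^ (k - m) :=
  MultilinearMap.norm_iteratedFDeriv_diagonal_le (E := Matrix (Fin n) (Fin n) ℂ)
    (F := SymPower n k →L[ℂ] SymPower n k) (symMultilinear n k) norm_symMultilinear_le
    symPow_eq_symMultilinear m A

/-! ### The extremal direction -/

theorem elementary_const_mem_symPower (x : EuclideanSpace ℂ (Fin n)) :
    elementary (fun _ : Fin k => x) ∈ SymPower n k :=
  fun σ f => Equiv.prod_comp σ fun i => x (f i)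

theorem elementary_const_smul (c : ℂ) (x : EuclideanSpace ℂ (Fin n)) :
    elementary (fun _ : Fin k => c • x) = c ^ k • elementary fun _ : Fin k => x := by
  ext f
  simp [elementary, Finset.prod_mul_distrib]

theorem norm_elementary_const (x : EuclideanSpace ℂ (Fin n)) :
    ‖elementary fun _ : Fin k => x‖ = ‖x‖ ^ k := by
  rw [← sq_eq_sq₀ (norm_nonneg _) (by positivity), ← Complex.ofReal_inj, Complex.ofReal_pow]
  have h := inner_elementary (fun _ : Fin k => x) fun _ => x
  simp only [inner_self_eq_norm_sq_to_K, Finset.prod_const, Finset.card_univ,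
    Fintype.card_fin] at h
  refine h.trans ?_
  push_cast
  exact pow_right_comm _ _ _

/-- In finite dimension an operator attains its norm on the unit sphere. -/
theorem exists_norm_eq_one_norm_apply_eq {E F : Type*} [NormedAddCommGroup E] [NormedSpace ℂ E]
    [FiniteDimensional ℂ E] [Nontrivial E] [NormedAddCommGroup F] [NormedSpace ℂ F]
    (T : E →L[ℂ] F) : ∃ v, ‖v‖ = 1 ∧ ‖T v‖ = ‖T‖ := by
  have : ProperSpace E := FiniteDimensional.proper ℂ E
  have : NormedSpace ℝ E := NormedSpace.restrictScalars ℝ ℂ E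
  have hne : (Metric.sphere (0 : E) 1).Nonempty := by
    obtain ⟨x, hx⟩ := exists_ne (0 : E)
    exact ⟨((‖x‖⁻¹ : ℝ) : ℂ) • x, by simp [norm_smul, hx]⟩
  obtain ⟨v, hv, hmax⟩ := (isCompact_sphere (0 : E) 1).exists_isMaxOn hne
    (T.continuous.norm.continuousOn)
  have hv1 : ‖v‖ = 1 := by simpa using hv
  refine ⟨v, hv1, le_antisymm (T.unit_le_opNorm v hv1.le) ?_⟩
  refine T.opNorm_le_of_unit_norm (𝕜 := ℂ) (norm_nonneg _) fun x hx => hmax (by simpa using hx)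

/-- There are a contraction `U` and unit vectors `v`, `w` with `U v = w` and `A v = ‖A‖ w`. -/
theorem exists_contraction (hn : 0 < n) (A : Matrix (Fin n) (Fin n) ℂ) :
    ∃ (U : Matrix (Fin n) (Fin n) ℂ) (v w : EuclideanSpace ℂ (Fin n)),
      ‖U‖ ≤ 1 ∧ ‖v‖ = 1 ∧ ‖w‖ = 1 ∧ Matrix.toEuclideanCLM (𝕜 := ℂ) U v = w ∧
        Matrix.toEuclideanCLM (𝕜 := ℂ) A v = (‖A‖ : ℂ) • w := by
  have : Nonempty (Fin n) := ⟨⟨0, hn⟩⟩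
  obtain ⟨v, hv, hAv⟩ := exists_norm_eq_one_norm_apply_eq (Matrix.toEuclideanCLM (𝕜 := ℂ) A)
  rw [Matrix.l2_opNorm_toEuclideanCLM] at hAv
  -- For `A = 0` every unit vector `w` will do.
  obtain ⟨w, hw, hAw⟩ : ∃ w : EuclideanSpace ℂ (Fin n), ‖w‖ = 1 ∧
      Matrix.toEuclideanCLM (𝕜 := ℂ) A v = (‖A‖ : ℂ) • w := by
    rcases eq_or_ne A 0 with rfl | hA
    · exact ⟨v, hv, by simp⟩
    · have hA' : ‖A‖ ≠ 0 := norm_ne_zero_iff.2 hA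
      have hA'' : (‖A‖ : ℂ) ≠ 0 := Complex.ofReal_ne_zero.2 hA'
      refine ⟨(‖A‖ : ℂ)⁻¹ • Matrix.toEuclideanCLM (𝕜 := ℂ) A v, ?_, ?_⟩
      · rw [norm_smul, hAv]
        simp [hA']
      · rw [smul_inv_smul₀ hA'']
  refine ⟨(Matrix.toEuclideanCLM (𝕜 := ℂ)).symm (InnerProductSpace.rankOne ℂ w v), v, w, ?_, hv,
    hw, ?_, hAw⟩
  · rw [← Matrix.l2_opNorm_toEuclideanCLM, StarAlgEquiv.apply_symm_apply]
    simp [hv, hw]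
  · rw [StarAlgEquiv.apply_symm_apply]
    simp [hv]

theorem le_norm_iteratedFDeriv_symPow (hn : 0 < n) (m : ℕ) (A : Matrix (Fin n) (Fin n) ℂ) :
    k.descFactorial m * ‖A‖ ^ (k - m) ≤
      ‖iteratedFDeriv ℂ m (fun B : Matrix (Fin n) (Fin n) ℂ => symPow k B) A‖ := by
  obtain ⟨U, v, w, hU, hv, hw, hUv, hAv⟩ := exists_contraction hn A
  let V : SymPower n k := ⟨elementary fun _ => v, elementary_const_mem_symPower v⟩
  let W : SymPower n k := ⟨elementary fun _ => w, elementary_const_mem_symPower w⟩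
  have hV : ‖V‖ = 1 := (norm_elementary_const v).trans (by simp [hv])
  have hW : ‖W‖ = 1 := (norm_elementary_const w).trans (by simp [hw])
  let E : (SymPower n k →L[ℂ] SymPower n k) →ₗ[ℂ] SymPower n k :=
    { toFun T := T V
      map_add' _ _ := rfl
      map_smul' _ _ := rfl }
  have hE (T : SymPower n k →L[ℂ] SymPower n k) : ‖E T‖ ≤ ‖T‖ :=
    (T.le_opNorm V).trans_eq (by rw [hV, mul_one])
  have hline (t : ℂ) : E (symPow k (A + t • U)) = ((‖A‖ : ℂ) + t) ^ k • W := by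
    refine Subtype.ext ?_
    change tensorPow k (A + t • U) (elementary fun _ => v) =
      ((‖A‖ : ℂ) + t) ^ k • elementary fun _ => w
    rw [tensorPow_elementary, ← elementary_const_smul]
    congr 1
    funext i
    rw [map_add, map_smul, add_apply, smul_apply, hUv, hAv,
      add_smul]
  have h := descFactorial_mul_norm_pow_le_norm_iteratedFDeriv (m := m) contDiff_symPow hU E hE hW
    hline
  rwa [Complex.norm_real, norm_norm] at h

end SymTensor

end

/-- The norms are the operator norms: of `A` on the Hilbert space `ℂⁿ`, of operators on
`∨^k ℂⁿ`, and of the `m`-linear map `D^m ∨^k (A)`. -/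
theorem mainTheorem1 (n m k : ℕ) (hm : 1 ≤ m) (hmk : m ≤ k) (hkn : k ≤ n)
    (A : Matrix (Fin n) (Fin n) ℂ) :
    ContDiff ℂ ∞ (fun B : Matrix (Fin n) (Fin n) ℂ => SymTensor.symPow k B) ∧
      ‖iteratedFDeriv ℂ m (fun B : Matrix (Fin n) (Fin n) ℂ => SymTensor.symPow k B) A‖ =
        (k.factorial : ℝ) / ((k - m).factorial : ℝ) * ‖A‖ ^ (k - m) := by
  refine ⟨SymTensor.contDiff_symPow, ?_⟩
  have hfac : (k.factorial : ℝ) / ((k - m).factorial : ℝ) = k.descFactorial m := by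
    rw [div_eq_iff (by positivity), mul_comm]
    exact_mod_cast (Nat.factorial_mul_descFactorial hmk).symm
  rw [hfac]
  exact le_antisymm (SymTensor.norm_iteratedFDeriv_symPow_le m A)
    (SymTensor.le_norm_iteratedFDeriv_symPow (by lia) m A)
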